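/- **Conventions.** Let $\mathcal A$ be a small 2-category and $\Sigma$ a family of arrows of $\mathcal A$ containing the identities and closed under composition. $\mathcal Cat$ is the 2-category of small categories (of a size such that the category $\mathcal L_\sigma(F)$ below is an object of it). "2-functor" means strict 2-functor. We write $\alpha\beta$ for horizontal and $\circ$ for vertical composition, and $f$ also for the identity 2-cell of $f$. *$\sigma$-filtered pair.* $(\mathcal A,\Sigma)$ is $\sigma$-filtered if $\mathcal A$ is non-empty and: (F0) for all objects $A,B$ there are arrows $A\to E$ and $B\to E$ in $\Sigma$; (F1) for all $f,g:A\to B$ with $g\in\Sigma$ there are an arrow $h:B\to E$ in $\Sigma$ and a 2-cell $\alpha: hf\Rightarrow hg$, and if moreover $f\in\Sigma$, they can be chosen with $\alpha$ invertible; (F2) for all 2-cells $\alpha,\beta:f\Rightarrow g:A\to B$ there is $h:B\to E$ in $\Sigma$ with $h\alpha=h\beta$. *$\sigma$-cones and $\sigma$-colimits.* For a 2-functor $F:\mathcal A\to\mathcal B$ and an object $E$ of $\mathcal B$, a $\sigma$-cone $\theta$ with vertex $E$ consists of arrows $\theta_A:FA\to E$ and 2-cells $\theta_f:\theta_B\,Ff\Rightarrow\theta_A$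 for all $f:A\to B$, such that $\theta_{id_A}=id_{\theta_A}$, $\theta_{gf}=\theta_f\circ\theta_gFf$, $\theta_f=\theta_g\circ\theta_BF\gamma$ for every 2-cell $\gamma:f\Rightarrow g$, and $\theta_f$ is invertible for $f\in\Sigma$. A morphism $\theta\to\theta'$ consists of 2-cells $\varphi_A:\theta_A\Rightarrow\theta'_A$ with $\theta'_f\circ\varphi_BFf=\varphi_A\circ\theta_f$ for all $f:A\to B$. This gives a category $Cones_\sigma(F,E)$. A $\sigma$-cone $\lambda$ with vertex $L$ is a $\sigma$-colimit of $F$ in $\mathcal B$ if for every object $E$ of $\mathcal B$ the functor $\lambda^*:\mathcal B(L,E)\to Cones_\sigma(F,E)$, given by composition with $\lambda$, is an isomorphism of categories. *Premorphisms.* Let $F:\mathcal A\to\mathcal Cat$ be a 2-functor. Consider the pairs $(x,A)$ with $A\in\mathcal A$ and $x\in FA$. A premorphism $(u,\xi,v):(x,A)\to(y,B)$ consists of arrows $u:A\to C$ in $\Sigma$ and $v:B\to C$ in $\mathcal A$, and an arrow $\xi:F(u)(x)\to F(v)(y)$ of $FC$. Premorphisms $(u_i,\xi_i,v_i):(x,A)\to(y,B)$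 with $u_i:A\to C_i$, $i=1,2$, are homotopical, $\xi_1\sim\xi_2$, if there are an object $D$, arrows $w_A:A\to D$, $w_B:B\to D$, $w_i:C_i\to D$ in $\Sigma$, invertible 2-cells $\alpha_i:w_A\Rightarrow w_iu_i$ and 2-cells $\beta_i:w_iv_i\Rightarrow w_B$ such that $$F(\beta_1)_y\circ F(w_1)(\xi_1)\circ F(\alpha_1)_x=F(\beta_2)_y\circ F(w_2)(\xi_2)\circ F(\alpha_2)_x .$$ Given premorphisms $(u',\xi,v'):(x,A)\to(y,B)$ and $(u,\zeta,v):(y,B)\to(z,C)$ with $u':A\to C'$ and $u:B\to C''$, and a 2-cell $\gamma:rv'\Rightarrow su$ with $r:C'\to D$ and $s:C''\to D$ in $\Sigma$, the composite over $\gamma$ is the premorphism $$\zeta\circ_\gamma\xi=\bigl(ru',\;F(s)(\zeta)\circ F(\gamma)_y\circ F(r)(\xi),\;sv\bigr):(x,A)\to(z,C).$$ **Theorem 2.12.** Let $(\mathcal A,\Sigma)$ be $\sigma$-filtered and let $F:\mathcal A\to\mathcal Cat$ be a 2-functor. Then: 1. $\sim$ is an equivalence relation on the premorphisms $(x,A)\to(y,B)$,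 for all $(x,A)$, $(y,B)$. 2. Any two composable premorphisms have a composite over some 2-cell $\gamma$ as above. If $\xi_1\sim\xi_2$ and $\zeta_1\sim\zeta_2$, then $\zeta_1\circ_{\gamma_1}\xi_1\sim\zeta_2\circ_{\gamma_2}\xi_2$ for all $\gamma_1,\gamma_2$ over which these composites can be formed. 3. The pairs $(x,A)$, with the classes $[(u,\xi,v)]$ of premorphisms modulo $\sim$ as arrows, the composition $[\zeta]\circ[\xi]=[\zeta\circ_\gamma\xi]$ (for arbitrary $\gamma$) and the identities $[(id_A,id_x,id_A)]$, form a category $\mathcal L_\sigma(F)$. 4. The formulas $$\lambda_A(x)=(x,A),\qquad \lambda_A(\xi)=[(id_A,\xi,id_A)],\qquad (\lambda_u)_x=[(id_B,id_{F(u)(x)},u)]:(F(u)(x),B)\to(x,A)$$ for $A\in\mathcal A$, $x\in FA$, $\xi:x\to y$ in $FA$ and $u:A\to B$ in $\mathcal A$, define a $\sigma$-cone $\lambda$ for $F$ with vertex $\mathcal L_\sigma(F)$, and this $\sigma$-cone is the $\sigma$-colimit of $F$ in $\mathcal Cat$. -/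

import Mathlib

open CategoryTheory Bicategory

universe w₁ v₁ u₁ w₂ v₂ u₂ v u

namespace SigmaColimit

section Definitions

variable {A : Type u₁} [Bicategory.{w₁, v₁} A] [Bicategory.Strict A]

/-- A pair `(A, S)` formed by a 2-category and a family of arrows (the arrows drawn with a circle)
is `σ`-filtered. -/
structure IsSigmaFiltered (S : MorphismProperty A) : Prop where
  nonempty : Nonempty A
  sF0 : ∀ a b : A, ∃ (e : A) (f : a ⟶ e) (g : b ⟶ e), S f ∧ S g
  sF1 : ∀ {a b : A} (f g : a ⟶ b), S g →
    ∃ (e : A) (h : b ⟶ e) (α : f ≫ h ⟶ g ≫ h), S h ∧ (S f → IsIso α)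
  sF2 : ∀ {a b : A} {f g : a ⟶ b} (α β : f ⟶ g),
    ∃ (e : A) (h : b ⟶ e), S h ∧ α ▷ h = β ▷ h

section Cones

variable {B : Type u₂} [Bicategory.{w₂, v₂} B]

/-- A `σ`-cone for `F` with vertex `E`: a lax cone `app a : F a ⟶ E`,
`hom f : app b ∘ F f ⟹ app a` for `f : a ⟶ b`, such that `hom f` is invertible for `f` in `S`.
The unitors, associators and structure isomorphisms `F.mapId`, `F.mapComp` which occur are all
identities when `B` is a 2-category and `F` a (strict) 2-functor. -/
structure SigmaCone (S : MorphismProperty A) (F : A ⥤ᵖ B) (E : B) where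
  app (a : A) : F.obj a ⟶ E
  hom {a b : A} (f : a ⟶ b) : F.map f ≫ app b ⟶ app a
  hom_id (a : A) : hom (𝟙 a) = (F.mapId a).hom ▷ app a ≫ (λ_ (app a)).hom
  hom_comp {a b c : A} (f : a ⟶ b) (g : b ⟶ c) :
    hom (f ≫ g) = (F.mapComp f g).hom ▷ app c ≫ (α_ (F.map f) (F.map g) (app c)).hom ≫
      F.map f ◁ hom g ≫ hom f
  hom_map₂ {a b : A} {f g : a ⟶ b} (γ : f ⟶ g) : hom f = F.map₂ γ ▷ app b ≫ hom g
  isIso_hom {a b : A} (f : a ⟶ b) : S f → IsIso (hom f)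

namespace SigmaCone

variable {S : MorphismProperty A} {F : A ⥤ᵖ B}

/-- Morphisms of `σ`-cones with the same vertex. -/
@[ext]
structure Hom {E : B} (θ θ' : SigmaCone S F E) where
  app (a : A) : θ.app a ⟶ θ'.app a
  comm {a b : A} (f : a ⟶ b) : F.map f ◁ app b ≫ θ'.hom f = θ.hom f ≫ app a

/-- The category `Cones_σ(F, E)`. -/
instance (E : B) : Category (SigmaCone S F E) where
  Hom θ θ' := Hom θ θ'
  id θ := { app := fun a => 𝟙 _, comm := by simp }
  comp φ ψ :=
    { app := fun a => φ.app a ≫ ψ.app a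
      comm := fun f => by
        rw [Bicategory.whiskerLeft_comp, Category.assoc, ψ.comm, ← Category.assoc, φ.comm,
          Category.assoc] }

/-- Composing the `σ`-cone `l` with vertex `L` with an arrow `g : L ⟶ E`. -/
def compArrow {L : B} (l : SigmaCone S F L) {E : B} (g : L ⟶ E) : SigmaCone S F E where
  app a := l.app a ≫ g
  hom f := (α_ _ _ _).inv ≫ l.hom f ▷ g
  hom_id a := by simp [l.hom_id]
  hom_comp f g := by simp [l.hom_comp]
  hom_map₂ γ := by rw [l.hom_map₂ γ]; simp
  isIso_hom f hf := by
    have := l.isIso_hom f hf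
    infer_instance

/-- The functor `l^* : B(L, E) ⥤ Cones_σ(F, E)` given by composition with the `σ`-cone `l`. -/
def precomp {L : B} (l : SigmaCone S F L) (E : B) : (L ⟶ E) ⥤ SigmaCone S F E where
  obj g := l.compArrow g
  map {g g'} η :=
    { app := fun a => l.app a ◁ η
      comm := fun f => by simp [compArrow, ← whisker_exchange] }
  map_id g := by apply Hom.ext; funext a; exact Bicategory.whiskerLeft_id _ _
  map_comp η η' := by apply Hom.ext; funext a; exact Bicategory.whiskerLeft_comp _ _ _

/-- The `σ`-cone `l` with vertex `L` exhibits `L` as the `σ`-colimit of `F`: for every object `E`,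
the functor `l^*` is an isomorphism of categories. -/
def IsColimit {L : B} (l : SigmaCone S F L) : Prop :=
  ∀ E : B, ∃ G : SigmaCone S F E ⥤ (L ⟶ E),
    l.precomp E ⋙ G = 𝟭 (L ⟶ E) ∧ G ⋙ l.precomp E = 𝟭 (SigmaCone S F E)

end SigmaCone

end Cones

/-- The objects `(x, A)` of `L_σ(F)`. -/
structure LObj (F : A ⥤ᵖ Cat.{v, u}) where
  base : A
  pt : F.obj base

/-- Premorphisms `(u, ξ, v) : (x, A) ⟶ (y, B)`: arrows `u : A ⟶ C` in `S` and `v : B ⟶ C`, and an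
arrow `ξ : F(u)(x) ⟶ F(v)(y)` of the category `F C`. -/
structure Premorphism (S : MorphismProperty A) (F : A ⥤ᵖ Cat.{v, u}) (X Y : LObj F) where
  apex : A
  left : X.base ⟶ apex
  left_mem : S left
  right : Y.base ⟶ apex
  cell : (F.map left).toFunctor.obj X.pt ⟶ (F.map right).toFunctor.obj Y.pt

namespace Premorphism

variable {S : MorphismProperty A} {F : A ⥤ᵖ Cat.{v, u}} {X Y Z : LObj F}

/-- The arrow `F(β)_y ∘ F(w)(ξ) ∘ F(α)_x : F(wA)(x) ⟶ F(wB)(y)` of `F D` obtained by pasting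
2-cells `α : wA ⟹ w u` and `β : w v ⟹ wB` to a premorphism `(u, ξ, v)`. -/
def paste (ξ : Premorphism S F X Y) {D : A} (w : ξ.apex ⟶ D) {wA : X.base ⟶ D} {wB : Y.base ⟶ D}
    (α : wA ⟶ ξ.left ≫ w) (β : ξ.right ≫ w ⟶ wB) :
    (F.map wA).toFunctor.obj X.pt ⟶ (F.map wB).toFunctor.obj Y.pt :=
  (F.map₂ α).toNatTrans.app X.pt ≫ (F.mapComp ξ.left w).hom.toNatTrans.app X.pt ≫
    (F.map w).toFunctor.map ξ.cell ≫
    (F.mapComp ξ.right w).inv.toNatTrans.app Y.pt ≫ (F.map₂ β).toNatTrans.app Y.pt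

/-- The relation "being homotopical" between premorphisms with the same domain and codomain. -/
def Homotopic (ξ₁ ξ₂ : Premorphism S F X Y) : Prop :=
  ∃ (D : A) (wA : X.base ⟶ D) (wB : Y.base ⟶ D) (w₁ : ξ₁.apex ⟶ D) (w₂ : ξ₂.apex ⟶ D)
    (α₁ : wA ⟶ ξ₁.left ≫ w₁) (α₂ : wA ⟶ ξ₂.left ≫ w₂)
    (β₁ : ξ₁.right ≫ w₁ ⟶ wB) (β₂ : ξ₂.right ≫ w₂ ⟶ wB),
    S wA ∧ S wB ∧ S w₁ ∧ S w₂ ∧ IsIso α₁ ∧ IsIso α₂ ∧ ξ₁.paste w₁ α₁ β₁ = ξ₂.paste w₂ α₂ β₂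

/-- The 2-cells `γ : r v' ⟹ s u`, with `r` and `s` in `S`, over which the composite of the
premorphisms `(u', ξ, v')` and `(u, ζ, v)` can be formed. -/
structure CompCell (ξ : Premorphism S F X Y) (ζ : Premorphism S F Y Z) where
  apex : A
  r : ξ.apex ⟶ apex
  s : ζ.apex ⟶ apex
  r_mem : S r
  s_mem : S s
  γ : ξ.right ≫ r ⟶ ζ.left ≫ s

/-- The composite `ζ ∘_γ ξ = (r u', F(s)(ζ) ∘ F(γ)_y ∘ F(r)(ξ), s v)`. -/
def compOver [S.IsMultiplicative] (ξ : Premorphism S F X Y) (ζ : Premorphism S F Y Z)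
    (c : CompCell ξ ζ) : Premorphism S F X Z where
  apex := c.apex
  left := ξ.left ≫ c.r
  left_mem := S.comp_mem _ _ ξ.left_mem c.r_mem
  right := ζ.right ≫ c.s
  cell :=
    (F.mapComp ξ.left c.r).hom.toNatTrans.app X.pt ≫
      (F.map c.r).toFunctor.map ξ.cell ≫
      (F.mapComp ξ.right c.r).inv.toNatTrans.app Y.pt ≫
      (F.map₂ c.γ).toNatTrans.app Y.pt ≫
      (F.mapComp ζ.left c.s).hom.toNatTrans.app Y.pt ≫
      (F.map c.s).toFunctor.map ζ.cell ≫
      (F.mapComp ζ.right c.s).inv.toNatTrans.app Z.pt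

/-- The premorphism `(id, F(id)(ξ), id) : (x, A) ⟶ (y, A)` given by an arrow `ξ : x ⟶ y` of `F A`
(recall that `F(id)` is the identity functor when `F` is a 2-functor). -/
def ofHom (S : MorphismProperty A) [S.IsMultiplicative] {a : A} {x y : F.obj a} (ξ : x ⟶ y) :
    Premorphism S F ⟨a, x⟩ ⟨a, y⟩ where
  apex := a
  left := 𝟙 a
  left_mem := S.id_mem a
  right := 𝟙 a
  cell := (F.map (𝟙 a)).toFunctor.map ξ

/-- The premorphism `(id, id, f) : (F(f)(x), B) ⟶ (x, A)` given by an arrow `f : A ⟶ B` and an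
object `x` of `F A` (for a 2-functor `F` the cell `F(id)(F(f)(x)) ⟶ F(f)(x)` is an identity). -/
def ofArrow (S : MorphismProperty A) [S.IsMultiplicative] {a b : A} (f : a ⟶ b) (x : F.obj a) :
    Premorphism S F ⟨b, (F.map f).toFunctor.obj x⟩ ⟨a, x⟩ where
  apex := b
  left := 𝟙 b
  left_mem := S.id_mem b
  right := f
  cell := (F.mapId b).hom.toNatTrans.app ((F.map f).toFunctor.obj x)

end Premorphism

/-- The arrows of `L_σ(F)`: classes of premorphisms modulo homotopy. -/
def LHom (S : MorphismProperty A) (F : A ⥤ᵖ Cat.{v, u}) (X Y : LObj F) : Type (max u₁ v₁ v) :=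
  Quot (Premorphism.Homotopic (S := S) (X := X) (Y := Y))

/-- The class of a premorphism. -/
def LHom.mk {S : MorphismProperty A} {F : A ⥤ᵖ Cat.{v, u}} {X Y : LObj F}
    (ξ : Premorphism S F X Y) : LHom S F X Y :=
  Quot.mk _ ξ

/-- The category structure of `L_σ(F)`, with objects `LObj F` and arrows `LHom S F X Y`: the
identity of `(x, A)` is the class of `(id, id, id)` and the composition of two classes is computed
over an arbitrary 2-cell (so there is at most one `LCategory S F` if any two composable
premorphisms can be composed over some 2-cell). -/
structure LCategory (S : MorphismProperty A) [S.IsMultiplicative] (F : A ⥤ᵖ Cat.{v, u}) where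
  comp {X Y Z : LObj F} : LHom S F X Y → LHom S F Y Z → LHom S F X Z
  comp_mk {X Y Z : LObj F} (ξ : Premorphism S F X Y) (ζ : Premorphism S F Y Z)
    (c : Premorphism.CompCell ξ ζ) :
    comp (LHom.mk ξ) (LHom.mk ζ) = LHom.mk (ξ.compOver ζ c)
  id_comp {X Y : LObj F} (f : LHom S F X Y) :
    comp (LHom.mk (Premorphism.ofHom S (𝟙 X.pt))) f = f
  comp_id {X Y : LObj F} (f : LHom S F X Y) :
    comp f (LHom.mk (Premorphism.ofHom S (𝟙 Y.pt))) = f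
  assoc {X Y Z W : LObj F} (f : LHom S F X Y) (g : LHom S F Y Z) (h : LHom S F Z W) :
    comp (comp f g) h = comp f (comp g h)

namespace LCategory

variable {S : MorphismProperty A} [S.IsMultiplicative] {F : A ⥤ᵖ Cat.{v, u}}

/-- The category `L_σ(F)`. -/
@[reducible]
def category (L : LCategory S F) : Category.{max u₁ v₁ v} (LObj F) where
  Hom X Y := LHom S F X Y
  id X := LHom.mk (Premorphism.ofHom S (𝟙 X.pt))
  comp f g := L.comp f g
  id_comp f := L.id_comp f
  comp_id f := L.comp_id f
  assoc f g h := L.assoc f g h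

/-- The category `L_σ(F)` as an object of `Cat`. -/
def toCat (L : LCategory S F) : Cat.{max u₁ v₁ v, max u₁ u} :=
  @Cat.of (LObj F) L.category

/-- The formula for `λ_A`, on objects and on arrows: `x ↦ (x, A)` and `ξ ↦ [(id, ξ, id)]`. -/
def inclusion (L : LCategory S F) (a : A) : F.obj a ⥤q L.toCat where
  obj x := (⟨a, x⟩ : LObj F)
  map ξ := LHom.mk (Premorphism.ofHom S ξ)

end LCategory

end Definitions

end SigmaColimit

open SigmaColimit

namespace SigmaColimit

section Elements

variable {A : Type u₁} [Bicategory.{w₁, v₁} A] (F : A ⥤ᵖ Cat.{v, u})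

/-- The component at `x` of the natural transformation `F(α)`. -/
def cellApp {a b : A} {f g : a ⟶ b} (α : f ⟶ g) (x : F.obj a) :
    (F.map f).toFunctor.obj x ⟶ (F.map g).toFunctor.obj x :=
  (F.map₂ α).toNatTrans.app x

/-- The component at `x` of the comparison `F(gf) ≅ F(g)F(f)`. -/
def compIso {a b c : A} (f : a ⟶ b) (g : b ⟶ c) (x : F.obj a) :
    (F.map (f ≫ g)).toFunctor.obj x ≅
      (F.map g).toFunctor.obj ((F.map f).toFunctor.obj x) where
  hom := (F.mapComp f g).hom.toNatTrans.app x
  inv := (F.mapComp f g).inv.toNatTrans.app x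
  hom_inv_id := Cat.Hom.hom_inv_id_toNatTrans_app _ _
  inv_hom_id := Cat.Hom.inv_hom_id_toNatTrans_app _ _

/-- The component at `x` of the comparison `F(id) ≅ id`. -/
def idIso (a : A) (x : F.obj a) : (F.map (𝟙 a)).toFunctor.obj x ≅ x where
  hom := (F.mapId a).hom.toNatTrans.app x
  inv := (F.mapId a).inv.toNatTrans.app x
  hom_inv_id := Cat.Hom.hom_inv_id_toNatTrans_app _ _
  inv_hom_id := Cat.Hom.inv_hom_id_toNatTrans_app _ _

variable {a b c d : A}

@[simp]
lemma cellApp_id (f : a ⟶ b) (x : F.obj a) : cellApp F (𝟙 f) x = 𝟙 _ := by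
  simp [cellApp]

@[simp]
lemma cellApp_comp {f g h : a ⟶ b} (α : f ⟶ g) (β : g ⟶ h) (x : F.obj a) :
    cellApp F (α ≫ β) x = cellApp F α x ≫ cellApp F β x := by
  simp [cellApp]

lemma cellApp_naturality {f g : a ⟶ b} (α : f ⟶ g) {x y : F.obj a} (ξ : x ⟶ y) :
    cellApp F α x ≫ (F.map g).toFunctor.map ξ = (F.map f).toFunctor.map ξ ≫ cellApp F α y :=
  ((F.map₂ α).toNatTrans.naturality ξ).symm

@[simp]
lemma map_comp_map (f : a ⟶ b) (g : b ⟶ c) {x y : F.obj a} (ξ : x ⟶ y) :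
    (F.map (f ≫ g)).toFunctor.map ξ =
      (compIso F f g x).hom ≫ (F.map g).toFunctor.map ((F.map f).toFunctor.map ξ) ≫
        (compIso F f g y).inv := by
  rw [← Category.assoc, Iso.eq_comp_inv]
  exact (F.mapComp f g).hom.toNatTrans.naturality ξ

@[simp]
lemma map_id_map {x y : F.obj a} (ξ : x ⟶ y) :
    (F.map (𝟙 a)).toFunctor.map ξ = (idIso F a x).hom ≫ ξ ≫ (idIso F a y).inv := by
  rw [← Category.assoc, Iso.eq_comp_inv]
  exact (F.mapId a).hom.toNatTrans.naturality ξ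

@[simp]
lemma cellApp_whiskerLeft (f : a ⟶ b) {g h : b ⟶ c} (β : g ⟶ h) (x : F.obj a) :
    cellApp F (f ◁ β) x = (compIso F f g x).hom ≫
      cellApp F β ((F.map f).toFunctor.obj x) ≫ (compIso F f h x).inv :=
  congrArg (fun η => η.toNatTrans.app x) (F.map₂_whisker_left f β)

@[simp]
lemma cellApp_whiskerRight {f g : a ⟶ b} (α : f ⟶ g) (h : b ⟶ c) (x : F.obj a) :
    cellApp F (α ▷ h) x = (compIso F f h x).hom ≫
      (F.map h).toFunctor.map (cellApp F α x) ≫ (compIso F g h x).inv :=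
  congrArg (fun η => η.toNatTrans.app x) (F.map₂_whisker_right α h)

lemma cellApp_hom_inv {f g : a ⟶ b} (α : f ≅ g) (x : F.obj a) :
    cellApp F α.hom x ≫ cellApp F α.inv x = 𝟙 _ := by
  rw [← cellApp_comp, α.hom_inv_id, cellApp_id]

lemma cellApp_inv_hom {f g : a ⟶ b} (α : f ≅ g) (x : F.obj a) :
    cellApp F α.inv x ≫ cellApp F α.hom x = 𝟙 _ := by
  rw [← cellApp_comp, α.inv_hom_id, cellApp_id]

/-- The isomorphism induced by an invertible 2-cell. -/
@[simps]
def cellIso {f g : a ⟶ b} (α : f ≅ g) (x : F.obj a) :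
    (F.map f).toFunctor.obj x ≅ (F.map g).toFunctor.obj x where
  hom := cellApp F α.hom x
  inv := cellApp F α.inv x
  hom_inv_id := cellApp_hom_inv F α x
  inv_hom_id := cellApp_inv_hom F α x

@[simp]
lemma cellApp_associator_hom (f : a ⟶ b) (g : b ⟶ c) (h : c ⟶ d) (x : F.obj a) :
    cellApp F (α_ f g h).hom x = (compIso F (f ≫ g) h x).hom ≫
      (F.map h).toFunctor.map (compIso F f g x).hom ≫
      (compIso F g h ((F.map f).toFunctor.obj x)).inv ≫ (compIso F f (g ≫ h) x).inv := by
  have := congrArg (fun η => η.toNatTrans.app x) (F.map₂_associator f g h)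
  simp only [Cat.Hom₂.comp_app] at this
  refine this.trans ?_
  congr 2
  exact Category.id_comp _

@[simp]
lemma cellApp_associator_inv (f : a ⟶ b) (g : b ⟶ c) (h : c ⟶ d) (x : F.obj a) :
    cellApp F (α_ f g h).inv x = (compIso F f (g ≫ h) x).hom ≫
      (compIso F g h ((F.map f).toFunctor.obj x)).hom ≫
      (F.map h).toFunctor.map (compIso F f g x).inv ≫ (compIso F (f ≫ g) h x).inv := by
  rw [← cancel_epi (cellIso F (α_ f g h) x).hom, cellIso_hom, cellApp_hom_inv]
  simp

@[simp]
lemma cellApp_leftUnitor_hom (f : a ⟶ b) (x : F.obj a) :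
    cellApp F (λ_ f).hom x = (compIso F (𝟙 a) f x).hom ≫
      (F.map f).toFunctor.map (idIso F a x).hom := by
  have := congrArg (fun η => η.toNatTrans.app x) (F.map₂_left_unitor f)
  simp only [Cat.Hom₂.comp_app] at this
  refine this.trans ?_
  congr 1
  exact Category.comp_id _

@[simp]
lemma cellApp_leftUnitor_inv (f : a ⟶ b) (x : F.obj a) :
    cellApp F (λ_ f).inv x = (F.map f).toFunctor.map (idIso F a x).inv ≫
      (compIso F (𝟙 a) f x).inv := by
  rw [← cancel_epi (cellIso F (λ_ f) x).hom, cellIso_hom, cellApp_hom_inv]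
  simp

@[simp]
lemma cellApp_rightUnitor_hom (f : a ⟶ b) (x : F.obj a) :
    cellApp F (ρ_ f).hom x = (compIso F f (𝟙 b) x).hom ≫
      (idIso F b ((F.map f).toFunctor.obj x)).hom := by
  have := congrArg (fun η => η.toNatTrans.app x) (F.map₂_right_unitor f)
  simp only [Cat.Hom₂.comp_app] at this
  refine this.trans ?_
  congr 1
  exact Category.comp_id _

@[simp]
lemma cellApp_rightUnitor_inv (f : a ⟶ b) (x : F.obj a) :
    cellApp F (ρ_ f).inv x = (idIso F b ((F.map f).toFunctor.obj x)).inv ≫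
      (compIso F f (𝟙 b) x).inv := by
  rw [← cancel_epi (cellIso F (ρ_ f) x).hom, cellIso_hom, cellApp_hom_inv]
  simp

end Elements

namespace IsSigmaFiltered

variable {A : Type u₁} [Bicategory.{w₁, v₁} A] [Bicategory.Strict A] {S : MorphismProperty A}
  [S.IsMultiplicative]

lemma exists_square (hS : IsSigmaFiltered S) {b c d : A} (f : b ⟶ c) (g : b ⟶ d) (hg : S g) :
    ∃ (e : A) (p : c ⟶ e) (q : d ⟶ e) (γ : f ≫ p ⟶ g ≫ q), S p ∧ S q ∧ (S f → IsIso γ) := by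
  obtain ⟨e, p, q, hp, hq⟩ := hS.sF0 c d
  obtain ⟨e', h, α, hh, hα⟩ := hS.sF1 (f ≫ p) (g ≫ q) (S.comp_mem _ _ hg hq)
  refine ⟨e', p ≫ h, q ≫ h, (α_ _ _ _).inv ≫ α ≫ (α_ _ _ _).hom, S.comp_mem _ _ hp hh,
    S.comp_mem _ _ hq hh, fun hf => ?_⟩
  have := hα (S.comp_mem _ _ hf hp)
  infer_instance

lemma exists_isoSquare (hS : IsSigmaFiltered S) {b c d : A} (f : b ⟶ c) (g : b ⟶ d)
    (hf : S f) (hg : S g) :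
    ∃ (e : A) (p : c ⟶ e) (q : d ⟶ e) (_ : f ≫ p ≅ g ≫ q), S p ∧ S q := by
  obtain ⟨e, p, q, γ, hp, hq, hγ⟩ := hS.exists_square f g hg
  have := hγ hf
  exact ⟨e, p, q, asIso γ, hp, hq⟩

/-- Two 2-cells `v w₁ ⟹ v₁` and `v w₂ ⟹ v₂` can be completed to a coherent diagram. -/
lemma exists_completion (hS : IsSigmaFiltered S) {b c d₁ d₂ : A} {v : b ⟶ c} {k₁ : c ⟶ d₁}
    {k₂ : c ⟶ d₂} {g₁ : b ⟶ d₁} {g₂ : b ⟶ d₂} (hk₁ : S k₁) (hk₂ : S k₂) (hg₂ : S g₂)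
    (β₁ : v ≫ k₁ ⟶ g₁) (β₂ : v ≫ k₂ ⟶ g₂) :
    ∃ (e : A) (p : d₁ ⟶ e) (q : d₂ ⟶ e) (θ : k₁ ≫ p ≅ k₂ ≫ q) (δ : g₁ ≫ p ⟶ g₂ ≫ q),
      S p ∧ S q ∧
      (α_ _ _ _).inv ≫ β₁ ▷ p ≫ δ = v ◁ θ.hom ≫ (α_ _ _ _).inv ≫ β₂ ▷ q := by
  obtain ⟨e₀, p, q, θ, hp, hq⟩ := hS.exists_isoSquare k₁ k₂ hk₁ hk₂
  obtain ⟨e₁, h, δ, hh, -⟩ := hS.sF1 (g₁ ≫ p) (g₂ ≫ q) (S.comp_mem _ _ hg₂ hq)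
  obtain ⟨e, k, hk, eq⟩ := hS.sF2
    ((α_ v k₁ p).inv ▷ h ≫ (β₁ ▷ p) ▷ h ≫ δ)
    ((v ◁ θ.hom) ▷ h ≫ (α_ v k₂ q).inv ▷ h ≫ (β₂ ▷ q) ▷ h)
  refine ⟨e, (p ≫ h) ≫ k, (q ≫ h) ≫ k,
    whiskerLeftIso k₁ (α_ p h k) ≪≫ (α_ _ _ _).symm ≪≫ whiskerRightIso θ (h ≫ k) ≪≫ (α_ _ _ _) ≪≫
      whiskerLeftIso k₂ (α_ q h k).symm,
    (α_ _ _ _).inv ≫ (α_ _ _ _).inv ▷ k ≫ δ ▷ k ≫ (α_ _ _ _).hom ▷ k ≫ (α_ _ _ _).hom,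
    S.comp_mem _ _ (S.comp_mem _ _ hp hh) hk, S.comp_mem _ _ (S.comp_mem _ _ hq hh) hk, ?_⟩
  have := congrArg (fun η => v ◁ k₁ ◁ (α_ p h k).hom ≫ v ◁ (α_ _ _ _).inv ≫ (α_ _ _ _).inv ≫
    (α_ _ _ _).inv ≫ η ≫ (α_ (g₂ ≫ q) h k).hom ≫ (α_ g₂ q (h ≫ k)).hom ≫ g₂ ◁ (α_ _ _ _).inv ≫
      (α_ _ _ _).inv ≫ (α_ _ _ _).hom) eq
  refine Eq.trans ?_ (this.trans ?_)
  · simp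
    bicategory
  · simp
    bicategory

/-- Two 2-cells `v r₁ ⟹ u s₁` and `v r₂ ⟹ u s₂` can be identified up to invertible 2-cells. -/
lemma exists_iso_completion (hS : IsSigmaFiltered S) {b c d e₁ e₂ : A} {v : b ⟶ c} {u : b ⟶ d}
    {r₁ : c ⟶ e₁} {s₁ : d ⟶ e₁} {r₂ : c ⟶ e₂} {s₂ : d ⟶ e₂} (hr₁ : S r₁) (hs₁ : S s₁)
    (hr₂ : S r₂) (hs₂ : S s₂) (γ₁ : v ≫ r₁ ⟶ u ≫ s₁) (γ₂ : v ≫ r₂ ⟶ u ≫ s₂) :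
    ∃ (e : A) (p : e₁ ⟶ e) (q : e₂ ⟶ e) (ρ : r₁ ≫ p ≅ r₂ ≫ q) (σ : s₁ ≫ p ≅ s₂ ≫ q),
      S p ∧ S q ∧
      γ₁ ▷ p ≫ (α_ _ _ _).hom ≫ u ◁ σ.hom =
        (α_ _ _ _).hom ≫ v ◁ ρ.hom ≫ (α_ _ _ _).inv ≫ γ₂ ▷ q ≫ (α_ _ _ _).hom := by
  obtain ⟨e₀, p, q, ρ, hp, hq⟩ := hS.exists_isoSquare r₁ r₂ hr₁ hr₂
  obtain ⟨e', h, σ, hh, hσ⟩ := hS.sF1 (s₁ ≫ p) (s₂ ≫ q) (S.comp_mem _ _ hs₂ hq)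
  have := hσ (S.comp_mem _ _ hs₁ hp)
  obtain ⟨e, k, hk, eq⟩ := hS.sF2
    ((γ₁ ▷ p) ▷ h ≫ (α_ _ _ _).hom ▷ h ≫ (α_ _ _ _).hom ≫ u ◁ σ ≫ (α_ _ _ _).inv)
    ((α_ _ _ _).hom ▷ h ≫ (v ◁ ρ.hom) ▷ h ≫ (α_ _ _ _).inv ▷ h ≫ (γ₂ ▷ q) ▷ h ≫
      (α_ _ _ _).hom ▷ h)
  refine ⟨e, (p ≫ h) ≫ k, (q ≫ h) ≫ k,
    whiskerLeftIso r₁ (α_ p h k) ≪≫ (α_ _ _ _).symm ≪≫ whiskerRightIso ρ (h ≫ k) ≪≫ (α_ _ _ _) ≪≫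
      whiskerLeftIso r₂ (α_ q h k).symm,
    (α_ _ _ _).symm ≪≫ whiskerRightIso (α_ _ _ _).symm k ≪≫ whiskerRightIso (asIso σ) k ≪≫
      whiskerRightIso (α_ _ _ _) k ≪≫ (α_ _ _ _),
    S.comp_mem _ _ (S.comp_mem _ _ hp hh) hk, S.comp_mem _ _ (S.comp_mem _ _ hq hh) hk, ?_⟩
  have := congrArg (fun η => (v ≫ r₁) ◁ (α_ p h k).hom ≫ (α_ _ _ _).inv ≫ (α_ _ _ _).inv ≫ η ≫
    (α_ _ h k).hom ≫ (α_ u _ (h ≫ k)).hom ≫ u ◁ (α_ s₂ q (h ≫ k)).hom ≫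
      u ◁ s₂ ◁ (α_ q h k).inv) eq
  refine Eq.trans ?_ (this.trans ?_)
  · simp
    bicategory
  · simp
    bicategory

end IsSigmaFiltered

namespace Premorphism

variable {A : Type u₁} [Bicategory.{w₁, v₁} A] [Bicategory.Strict A] {S : MorphismProperty A}
  {F : A ⥤ᵖ Cat.{v, u}} {X Y Z W : LObj F}

lemma paste_eq (ξ : Premorphism S F X Y) {D : A} (w : ξ.apex ⟶ D) {wA : X.base ⟶ D}
    {wB : Y.base ⟶ D} (α : wA ⟶ ξ.left ≫ w) (β : ξ.right ≫ w ⟶ wB) :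
    ξ.paste w α β = cellApp F α X.pt ≫ (compIso F ξ.left w X.pt).hom ≫
      (F.map w).toFunctor.map ξ.cell ≫ (compIso F ξ.right w Y.pt).inv ≫ cellApp F β Y.pt :=
  rfl

/-- An extension of a premorphism `ξ`: a premorphism obtained by pasting 2-cells to `ξ`. -/
structure Extension (ξ ξ' : Premorphism S F X Y) where
  w : ξ.apex ⟶ ξ'.apex
  w_mem : S w
  α : ξ'.left ≅ ξ.left ≫ w
  β : ξ.right ≫ w ⟶ ξ'.right
  cell_eq : ξ'.cell = ξ.paste w α.hom β

/-- The premorphism obtained by pasting 2-cells to `ξ`. -/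
abbrev pasted (ξ : Premorphism S F X Y) {D : A} (w : ξ.apex ⟶ D) {wA : X.base ⟶ D}
    (hwA : S wA) {wB : Y.base ⟶ D} (α : wA ≅ ξ.left ≫ w) (β : ξ.right ≫ w ⟶ wB) :
    Premorphism S F X Y where
  apex := D
  left := wA
  left_mem := hwA
  right := wB
  cell := ξ.paste w α.hom β

/-- A pasted premorphism is an extension. -/
def pastedExtension (ξ : Premorphism S F X Y) {D : A} (w : ξ.apex ⟶ D) (hw : S w)
    {wA : X.base ⟶ D} (hwA : S wA) {wB : Y.base ⟶ D} (α : wA ≅ ξ.left ≫ w)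
    (β : ξ.right ≫ w ⟶ wB) : Extension ξ (ξ.pasted w hwA α β) where
  w := w
  w_mem := hw
  α := α
  β := β
  cell_eq := rfl

lemma paste_paste (ξ ξ' : Premorphism S F X Y) (e : Extension ξ ξ') {D : A}
    (w : ξ'.apex ⟶ D) {wA : X.base ⟶ D} {wB : Y.base ⟶ D} (α : wA ⟶ ξ'.left ≫ w)
    (β : ξ'.right ≫ w ⟶ wB) :
    ξ'.paste w α β = ξ.paste (e.w ≫ w) (α ≫ e.α.hom ▷ w ≫ (α_ _ _ _).hom)
      ((α_ _ _ _).inv ≫ e.β ▷ w ≫ β) := by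
  simp [paste_eq, e.cell_eq]

lemma paste_congr (ξ : Premorphism S F X Y) {D : A} {w w' : ξ.apex ⟶ D} {wA : X.base ⟶ D}
    {wB : Y.base ⟶ D} {α : wA ⟶ ξ.left ≫ w} {α' : wA ⟶ ξ.left ≫ w'} {β : ξ.right ≫ w ⟶ wB}
    {β' : ξ.right ≫ w' ⟶ wB} (θ : w ⟶ w') (hα : α ≫ ξ.left ◁ θ = α')
    (hβ : β = ξ.right ◁ θ ≫ β') : ξ.paste w α β = ξ.paste w' α' β' := by
  subst hα hβ
  have := cellApp_naturality F θ ξ.cell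
  simp [paste_eq, reassoc_of% this]

/-- Extensions can be composed. -/
def Extension.trans [S.IsMultiplicative] {ξ ξ' ξ'' : Premorphism S F X Y} (e : Extension ξ ξ')
    (e' : Extension ξ' ξ'') : Extension ξ ξ'' where
  w := e.w ≫ e'.w
  w_mem := S.comp_mem _ _ e.w_mem e'.w_mem
  α := e'.α ≪≫ whiskerRightIso e.α e'.w ≪≫ α_ _ _ _
  β := (α_ _ _ _).inv ≫ e.β ▷ e'.w ≫ e'.β
  cell_eq := by
    rw [e'.cell_eq, paste_paste ξ ξ' e]
    simp

/-- Every premorphism has an extension whose right leg is in `S`. -/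
lemma exists_extension_right_mem [S.IsMultiplicative] (hS : IsSigmaFiltered S)
    (ξ : Premorphism S F X Y) :
    ∃ ξ' : Premorphism S F X Y, Nonempty (Extension ξ ξ') ∧ S ξ'.right := by
  obtain ⟨e, p, q, γ, hp, hq, -⟩ := hS.exists_square ξ.right (𝟙 Y.base) (S.id_mem _)
  exact ⟨_, ⟨ξ.pastedExtension p hp (S.comp_mem _ _ ξ.left_mem hp) (Iso.refl _) γ⟩,
    S.comp_mem _ _ (S.id_mem _) hq⟩

lemma homotopic_iff {ξ₁ ξ₂ : Premorphism S F X Y} :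
    ξ₁.Homotopic ξ₂ ↔ ∃ ξ' : Premorphism S F X Y, Nonempty (Extension ξ₁ ξ') ∧
      Nonempty (Extension ξ₂ ξ') ∧ S ξ'.right := by
  constructor
  · rintro ⟨D, wA, wB, k₁, k₂, α₁, α₂, β₁, β₂, hA, hB, h₁, h₂, _, _, eq⟩
    exact ⟨ξ₁.pasted k₁ hA (asIso α₁) β₁, ⟨ξ₁.pastedExtension k₁ h₁ hA _ _⟩,
      ⟨{ w := k₂, w_mem := h₂, α := @asIso _ _ _ _ α₂ ‹_›, β := β₂, cell_eq := eq }⟩, hB⟩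
  · rintro ⟨ξ', ⟨e₁⟩, ⟨e₂⟩, h⟩
    exact ⟨ξ'.apex, ξ'.left, ξ'.right, e₁.w, e₂.w, e₁.α.hom, e₂.α.hom, e₁.β, e₂.β, ξ'.left_mem, h,
      e₁.w_mem, e₂.w_mem, inferInstance, inferInstance, e₁.cell_eq.symm.trans e₂.cell_eq⟩

variable [S.IsMultiplicative]

/-- Two extensions of the same premorphism have a common extension. -/
lemma exists_common_extension (hS : IsSigmaFiltered S) {ξ ξ₁ ξ₂ : Premorphism S F X Y}
    (e₁ : Extension ξ ξ₁) (e₂ : Extension ξ ξ₂) :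
    ∃ ξ' : Premorphism S F X Y, Nonempty (Extension ξ₁ ξ') ∧ Nonempty (Extension ξ₂ ξ') := by
  obtain ⟨ξ₃, ⟨e₃⟩, h₃⟩ := exists_extension_right_mem hS ξ₂
  suffices ∃ ξ' : Premorphism S F X Y, Nonempty (Extension ξ₁ ξ') ∧ Nonempty (Extension ξ₃ ξ') by
    obtain ⟨ξ', h₁, ⟨h₂⟩⟩ := this
    exact ⟨ξ', h₁, ⟨e₃.trans h₂⟩⟩
  generalize e₂.trans e₃ = e at *
  obtain ⟨D, p, q, θ, δ, hp, hq, eq⟩ :=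
    hS.exists_completion e₁.w_mem e.w_mem h₃ e₁.β e.β
  refine ⟨ξ₁.pasted p (S.comp_mem _ _ ξ₁.left_mem hp) (Iso.refl _) δ,
    ⟨ξ₁.pastedExtension p hp _ _ _⟩, ⟨q, hq,
      whiskerRightIso e₁.α p ≪≫ α_ _ _ _ ≪≫ whiskerLeftIso _ θ ≪≫ (α_ _ _ _).symm ≪≫
        whiskerRightIso e.α.symm q, 𝟙 _, ?_⟩⟩
  refine (paste_paste ξ ξ₁ e₁ _ _ _).trans (Eq.trans (paste_congr ξ θ.hom ?_ ?_)
    (paste_paste ξ ξ₃ e _ _ _).symm)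
  · simp [← comp_whiskerRight_assoc]
  · rw [eq]
    simp

lemma Extension.homotopic (hS : IsSigmaFiltered S) {ξ ξ' : Premorphism S F X Y}
    (e : Extension ξ ξ') : ξ.Homotopic ξ' := by
  obtain ⟨ξ'', ⟨e'⟩, h⟩ := exists_extension_right_mem hS ξ'
  exact homotopic_iff.2 ⟨ξ'', ⟨e.trans e'⟩, ⟨e'⟩, h⟩

/-- Homotopy of premorphisms is an equivalence relation. -/
theorem equivalence_homotopic (hS : IsSigmaFiltered S) (X Y : LObj F) :
    Equivalence (Homotopic (S := S) (X := X) (Y := Y)) where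
  refl ξ := by
    obtain ⟨ξ', h, h'⟩ := exists_extension_right_mem hS ξ
    exact homotopic_iff.2 ⟨ξ', h, h, h'⟩
  symm := by
    simp only [homotopic_iff]
    rintro ξ₁ ξ₂ ⟨ξ', h₁, h₂, h⟩
    exact ⟨ξ', h₂, h₁, h⟩
  trans := by
    simp only [homotopic_iff]
    rintro ξ₁ ξ₂ ξ₃ ⟨ξ, ⟨e₁⟩, ⟨e₂⟩, -⟩ ⟨ξ', ⟨e₂'⟩, ⟨e₃⟩, -⟩
    obtain ⟨ξ'', ⟨e⟩, ⟨e'⟩⟩ := exists_common_extension hS e₂ e₂'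
    obtain ⟨η, ⟨f⟩, h⟩ := exists_extension_right_mem hS ξ''
    exact ⟨η, ⟨(e₁.trans e).trans f⟩, ⟨(e₃.trans e').trans f⟩, h⟩

lemma extension_mk {D : A} {u u' : X.base ⟶ D} {v v' : Y.base ⟶ D}
    {ξ : (F.map u).toFunctor.obj X.pt ⟶ (F.map v).toFunctor.obj Y.pt}
    {ξ' : (F.map u').toFunctor.obj X.pt ⟶ (F.map v').toFunctor.obj Y.pt} (α : u' ≅ u) (β : v ⟶ v')
    (hu : S u) (hu' : S u') (h : ξ' = cellApp F α.hom X.pt ≫ ξ ≫ cellApp F β Y.pt) :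
    Nonempty (Extension (S := S) ⟨D, u, hu, v, ξ⟩ ⟨D, u', hu', v', ξ'⟩) :=
  ⟨{
    w := 𝟙 _
    w_mem := S.id_mem _
    α := α ≪≫ (ρ_ _).symm
    β := (ρ_ _).hom ≫ β
    cell_eq := by simp [paste_eq, h] }⟩

lemma nonempty_compCell (hS : IsSigmaFiltered S) (ξ : Premorphism S F X Y)
    (ζ : Premorphism S F Y Z) : Nonempty (CompCell ξ ζ) := by
  obtain ⟨e, p, q, γ, hp, hq, -⟩ := hS.exists_square ξ.right ζ.left ζ.left_mem
  exact ⟨⟨e, p, q, hp, hq, γ⟩⟩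

lemma compOver_mk (ξ : Premorphism S F X Y) (ζ : Premorphism S F Y Z) {D : A} (r : ξ.apex ⟶ D)
    (s : ζ.apex ⟶ D) (hr : S r) (hs : S s) (γ : ξ.right ≫ r ⟶ ζ.left ≫ s) :
    ξ.compOver ζ ⟨D, r, s, hr, hs, γ⟩ = ⟨D, ξ.left ≫ r, S.comp_mem _ _ ξ.left_mem hr, ζ.right ≫ s,
      (compIso F ξ.left r X.pt).hom ≫
        (F.map r).toFunctor.map ξ.cell ≫ (compIso F ξ.right r Y.pt).inv ≫
        cellApp F γ Y.pt ≫ (compIso F ζ.left s Y.pt).hom ≫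
        (F.map s).toFunctor.map ζ.cell ≫ (compIso F ζ.right s Z.pt).inv⟩ :=
  rfl

/-- If the 2-cell `c'` is obtained from `c` by pasting invertible 2-cells, then the composite
over `c'` is an extension of the composite over `c`. -/
lemma extension_compOver {ξ : Premorphism S F X Y} {ζ : Premorphism S F Y Z} (c c' : CompCell ξ ζ)
    (p : c.apex ⟶ c'.apex) (hp : S p) (ρ : c.r ≫ p ≅ c'.r) (σ : c.s ≫ p ≅ c'.s)
    (h : c.γ ▷ p ≫ (α_ _ _ _).hom ≫ ζ.left ◁ σ.hom =
      (α_ _ _ _).hom ≫ ξ.right ◁ ρ.hom ≫ c'.γ) :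
    Nonempty (Extension (ξ.compOver ζ c) (ξ.compOver ζ c')) := by
  obtain ⟨D, r, s, hr, hs, γ⟩ := c'
  obtain ⟨D', r', s', hr', hs', γ'⟩ := c
  dsimp only at p ρ σ h
  have h₁ := cellApp_naturality F ρ.inv ξ.cell
  have h₂ := cellApp_naturality F σ.hom ζ.cell
  have h₃ : γ = ξ.right ◁ ρ.inv ≫ (α_ _ _ _).inv ≫ γ' ▷ p ≫ (α_ _ _ _).hom ≫
    ζ.left ◁ σ.hom := by rw [h]; simp
  rw [compOver_mk, compOver_mk]
  refine ⟨{
    w := p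
    w_mem := hp
    α := whiskerLeftIso _ ρ.symm ≪≫ (α_ _ _ _).symm
    β := (α_ _ _ _).hom ≫ _ ◁ σ.hom
    cell_eq := ?_ }⟩
  simp only [paste_eq, h₃, Functor.map_comp, cellApp_comp, cellApp_whiskerLeft,
    cellApp_whiskerRight, Category.assoc, Iso.inv_hom_id_assoc, reassoc_of% h₂, ← reassoc_of% h₁]
  simp

lemma exists_common_extension_compOver (hS : IsSigmaFiltered S) {ξ : Premorphism S F X Y}
    {ζ : Premorphism S F Y Z} (c₁ c₂ : CompCell ξ ζ) :
    ∃ c : CompCell ξ ζ, Nonempty (Extension (ξ.compOver ζ c₁) (ξ.compOver ζ c)) ∧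
      Nonempty (Extension (ξ.compOver ζ c₂) (ξ.compOver ζ c)) := by
  obtain ⟨e, p, q, ρ, σ, hp, hq, eq⟩ := hS.exists_iso_completion c₁.r_mem c₁.s_mem c₂.r_mem
    c₂.s_mem c₁.γ c₂.γ
  refine ⟨⟨e, c₂.r ≫ q, c₂.s ≫ q, S.comp_mem _ _ c₂.r_mem hq, S.comp_mem _ _ c₂.s_mem hq,
    (α_ _ _ _).inv ≫ c₂.γ ▷ q ≫ (α_ _ _ _).hom⟩, extension_compOver _ _ p hp ρ σ eq,
    extension_compOver _ _ q hq (Iso.refl _) (Iso.refl _) (by simp)⟩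

lemma exists_extension_compOver {ξ ξ' : Premorphism S F X Y} {ζ ζ' : Premorphism S F Y Z}
    (e : Extension ξ ξ') (e' : Extension ζ ζ') (c : CompCell ξ' ζ') :
    ∃ c₀ : CompCell ξ ζ, Nonempty (Extension (ξ.compOver ζ c₀) (ξ'.compOver ζ' c)) := by
  obtain ⟨D, r, s, hr, hs, γ⟩ := c
  refine ⟨⟨D, e.w ≫ r, e'.w ≫ s, S.comp_mem _ _ e.w_mem hr, S.comp_mem _ _ e'.w_mem hs,
    (α_ _ _ _).inv ≫ e.β ▷ r ≫ γ ≫ e'.α.hom ▷ s ≫ (α_ _ _ _).hom⟩, ?_⟩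
  rw [compOver_mk, compOver_mk]
  refine extension_mk (whiskerRightIso e.α r ≪≫ α_ _ _ _)
    ((α_ _ _ _).inv ≫ e'.β ▷ s) _ _ ?_
  simp [paste_eq, e.cell_eq, e'.cell_eq]

/-- Homotopy is compatible with composition. -/
theorem Homotopic.compOver (hS : IsSigmaFiltered S) {ξ₁ ξ₂ : Premorphism S F X Y}
    {ζ₁ ζ₂ : Premorphism S F Y Z} (c₁ : CompCell ξ₁ ζ₁) (c₂ : CompCell ξ₂ ζ₂)
    (hξ : ξ₁.Homotopic ξ₂) (hζ : ζ₁.Homotopic ζ₂) :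
    (ξ₁.compOver ζ₁ c₁).Homotopic (ξ₂.compOver ζ₂ c₂) := by
  obtain ⟨ξ, ⟨e₁⟩, ⟨e₂⟩, -⟩ := homotopic_iff.1 hξ
  obtain ⟨ζ, ⟨f₁⟩, ⟨f₂⟩, -⟩ := homotopic_iff.1 hζ
  obtain ⟨c⟩ := nonempty_compCell hS ξ ζ
  have key {ξ' : Premorphism S F X Y} {ζ' : Premorphism S F Y Z} (c' : CompCell ξ' ζ')
      (e : Extension ξ' ξ) (f : Extension ζ' ζ) :
      (ξ'.compOver ζ' c').Homotopic (ξ.compOver ζ c) := by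
    obtain ⟨c₀, ⟨k⟩⟩ := exists_extension_compOver e f c
    obtain ⟨c'', ⟨g⟩, ⟨g'⟩⟩ := exists_common_extension_compOver hS c' c₀
    have E := equivalence_homotopic (S := S) hS X Z
    exact E.trans (g.homotopic hS) (E.trans (E.symm (g'.homotopic hS)) (k.homotopic hS))
  have E := equivalence_homotopic (S := S) hS X Z
  exact E.trans (key c₁ e₁ f₁) (E.symm (key c₂ e₂ f₂))

end Premorphism

open Premorphism

namespace LHom

variable {A : Type u₁} [Bicategory.{w₁, v₁} A] [Bicategory.Strict A] {S : MorphismProperty A}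
  [S.IsMultiplicative] {F : A ⥤ᵖ Cat.{v, u}}

/-- The class of the premorphism `(u, ξ, v)`. -/
def cls {X Y : LObj F} {D : A} (u : X.base ⟶ D) (hu : S u) (v : Y.base ⟶ D)
    (ξ : (F.map u).toFunctor.obj X.pt ⟶ (F.map v).toFunctor.obj Y.pt) : LHom S F X Y :=
  LHom.mk ⟨D, u, hu, v, ξ⟩

lemma mk_eq_of_extension (hS : IsSigmaFiltered S) {X Y : LObj F} {ξ ξ' : Premorphism S F X Y}
    (e : Nonempty (Extension ξ ξ')) : LHom.mk ξ = LHom.mk ξ' :=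
  Quot.sound (e.some.homotopic hS)

lemma cls_eq (hS : IsSigmaFiltered S) {X Y : LObj F} {D : A} {u u' : X.base ⟶ D}
    {v v' : Y.base ⟶ D} {ξ : (F.map u).toFunctor.obj X.pt ⟶ (F.map v).toFunctor.obj Y.pt}
    {ξ' : (F.map u').toFunctor.obj X.pt ⟶ (F.map v').toFunctor.obj Y.pt} (α : u' ≅ u) (β : v ⟶ v')
    {hu : S u} {hu' : S u'} (h : ξ' = cellApp F α.hom X.pt ≫ ξ ≫ cellApp F β Y.pt) :
    cls u hu v ξ = cls u' hu' v' ξ' :=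
  mk_eq_of_extension hS (extension_mk α β hu hu' h)

lemma cls_eq_push (hS : IsSigmaFiltered S) {X Y : LObj F} {D E : A}
    (u : X.base ⟶ D) (hu : S u) (v : Y.base ⟶ D)
    (ξ : (F.map u).toFunctor.obj X.pt ⟶ (F.map v).toFunctor.obj Y.pt) (p : D ⟶ E) (hp : S p) :
    cls u hu v ξ = cls (u ≫ p) (S.comp_mem _ _ hu hp) (v ≫ p)
      ((compIso F u p X.pt).hom ≫ (F.map p).toFunctor.map ξ ≫ (compIso F v p Y.pt).inv) :=
  mk_eq_of_extension hS ⟨{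
    w := p
    w_mem := hp
    α := Iso.refl _
    β := 𝟙 _
    cell_eq := by simp [paste_eq] }⟩

lemma exists_cls (hS : IsSigmaFiltered S) {X Y : LObj F} (f : LHom S F X Y) :
    ∃ (D : A) (u : X.base ⟶ D) (hu : S u) (v : Y.base ⟶ D) (_ : S v)
      (ξ : (F.map u).toFunctor.obj X.pt ⟶ (F.map v).toFunctor.obj Y.pt), f = cls u hu v ξ := by
  obtain ⟨ξ', rfl⟩ := Quot.exists_rep f
  obtain ⟨⟨D, u, hu, v, ξ⟩, e, hv⟩ := exists_extension_right_mem hS ξ'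
  exact ⟨D, u, hu, v, hv, ξ, mk_eq_of_extension hS e⟩

/-- The composition of classes of premorphisms. -/
noncomputable def comp (hS : IsSigmaFiltered S) {X Y Z : LObj F} (f : LHom S F X Y)
    (g : LHom S F Y Z) : LHom S F X Z :=
  LHom.mk (f.out.compOver g.out (nonempty_compCell hS _ _).some)

lemma comp_mk (hS : IsSigmaFiltered S) {X Y Z : LObj F} (ξ : Premorphism S F X Y)
    (ζ : Premorphism S F Y Z) (c : CompCell ξ ζ) :
    comp hS (LHom.mk ξ) (LHom.mk ζ) = LHom.mk (ξ.compOver ζ c) :=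
  Quot.sound (Homotopic.compOver hS _ _
    ((equivalence_homotopic hS _ _).quot_mk_eq_iff _ _ |>.1 (Quot.out_eq _))
    ((equivalence_homotopic hS _ _).quot_mk_eq_iff _ _ |>.1 (Quot.out_eq _)))

lemma comp_cls (hS : IsSigmaFiltered S) {X Y Z : LObj F} {C C' D : A} {u' : X.base ⟶ C}
    {hu' : S u'} {v' : Y.base ⟶ C}
    {ξ : (F.map u').toFunctor.obj X.pt ⟶ (F.map v').toFunctor.obj Y.pt}
    {u : Y.base ⟶ C'} {hu : S u} {v : Z.base ⟶ C'}
    {ζ : (F.map u).toFunctor.obj Y.pt ⟶ (F.map v).toFunctor.obj Z.pt} (r : C ⟶ D) (s : C' ⟶ D)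
    (hr : S r) (hs : S s) (γ : v' ≫ r ⟶ u ≫ s) :
    comp hS (cls u' hu' v' ξ) (cls u hu v ζ) =
      cls (u' ≫ r) (S.comp_mem _ _ hu' hr) (v ≫ s)
        ((compIso F u' r X.pt).hom ≫
          (F.map r).toFunctor.map ξ ≫ (compIso F v' r Y.pt).inv ≫
          cellApp F γ Y.pt ≫ (compIso F u s Y.pt).hom ≫
          (F.map s).toFunctor.map ζ ≫ (compIso F v s Z.pt).inv) :=
  comp_mk hS ⟨C, u', hu', v', ξ⟩ ⟨C', u, hu, v, ζ⟩ ⟨D, r, s, hr, hs, γ⟩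

variable (S) in
/-- The class `λ_a(ξ)`. -/
def ofHom {a : A} {x y : F.obj a} (ξ : x ⟶ y) : LHom S F ⟨a, x⟩ ⟨a, y⟩ :=
  LHom.mk (Premorphism.ofHom S ξ)

variable (S) in
/-- The class `(λ_f)_x`. -/
def ofArrow {a b : A} (f : a ⟶ b) (x : F.obj a) :
    LHom S F ⟨b, (F.map f).toFunctor.obj x⟩ ⟨a, x⟩ :=
  LHom.mk (Premorphism.ofArrow S f x)

/-- The inverse of `(λ_f)_x` for `f` in `S`. -/
def ofArrowInv {a b : A} (f : a ⟶ b) (hf : S f) (x : F.obj a) :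
    LHom S F ⟨a, x⟩ ⟨b, (F.map f).toFunctor.obj x⟩ :=
  cls (X := ⟨a, x⟩) (Y := ⟨b, (F.map f).toFunctor.obj x⟩) f hf (𝟙 b) (idIso F b _).inv

lemma ofHom_eq {a : A} {x y : F.obj a} (ξ : x ⟶ y) :
    ofHom S ξ = cls (X := ⟨a, x⟩) (Y := ⟨a, y⟩) (𝟙 a) (S.id_mem a) (𝟙 a)
      ((F.map (𝟙 a)).toFunctor.map ξ) :=
  rfl

lemma ofArrow_eq {a b : A} (f : a ⟶ b) (x : F.obj a) :
    ofArrow S f x = cls (X := ⟨b, (F.map f).toFunctor.obj x⟩) (Y := ⟨a, x⟩) (𝟙 b) (S.id_mem b) f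
      (idIso F b _).hom :=
  rfl

variable (hS : IsSigmaFiltered S)

lemma ofHom_comp_cls {a : A} {x y : F.obj a} (η : x ⟶ y) {Z : LObj F} {D : A} (u : a ⟶ D)
    (hu : S u) (v : Z.base ⟶ D)
    (ζ : (F.map u).toFunctor.obj y ⟶ (F.map v).toFunctor.obj Z.pt) :
    comp hS (ofHom S η) (cls (X := ⟨a, y⟩) u hu v ζ) =
      cls (X := ⟨a, x⟩) u hu v ((F.map u).toFunctor.map η ≫ ζ) := by
  rw [ofHom_eq, comp_cls hS u (𝟙 D) hu (S.id_mem D) ((λ_ u).hom ≫ (ρ_ u).inv)]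
  exact cls_eq hS (λ_ u).symm (ρ_ v).hom (by simp)

lemma cls_comp_ofHom {X : LObj F} {D a : A} {x y : F.obj a} (u : X.base ⟶ D)
    (hu : S u) (v : a ⟶ D)
    (ζ : (F.map u).toFunctor.obj X.pt ⟶ (F.map v).toFunctor.obj x) (η : x ⟶ y) :
    comp hS (cls (Y := ⟨a, x⟩) u hu v ζ) (ofHom S η) =
      cls (Y := ⟨a, y⟩) u hu v (ζ ≫ (F.map v).toFunctor.map η) := by
  obtain ⟨e, p, q, γ, hp, hq, -⟩ := hS.exists_square v (𝟙 a) (S.id_mem a)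
  have := cellApp_naturality F γ η
  simp only [map_comp_map, map_id_map, Functor.map_comp, Category.assoc] at this
  rw [ofHom_eq, comp_cls hS p q hp hq γ, cls_eq_push hS (Y := ⟨a, y⟩) u hu v _ p hp]
  exact (cls_eq hS (Iso.refl _) γ (by simp [this])).symm

lemma cls_comp_ofArrow {X : LObj F} {D a b : A} (f : a ⟶ b) (x : F.obj a) (u : X.base ⟶ D)
    (hu : S u) (v : b ⟶ D)
    (ζ : (F.map u).toFunctor.obj X.pt ⟶
      (F.map v).toFunctor.obj ((F.map f).toFunctor.obj x)) :
    comp hS (cls (Y := ⟨b, (F.map f).toFunctor.obj x⟩) u hu v ζ) (ofArrow S f x) =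
      cls (Y := ⟨a, x⟩) u hu (f ≫ v) (ζ ≫ (compIso F f v x).inv) := by
  obtain ⟨e, p, q, γ, hp, hq, -⟩ := hS.exists_square v (𝟙 b) (S.id_mem b)
  rw [ofArrow_eq, comp_cls hS p q hp hq γ, cls_eq_push hS (Y := ⟨a, x⟩) u hu (f ≫ v)
    _ p hp]
  exact (cls_eq hS (Iso.refl _) ((α_ _ _ _).hom ≫ f ◁ (γ ≫ (λ_ q).hom)) (by simp)).symm

lemma id_comp {X Y : LObj F} (f : LHom S F X Y) : comp hS (ofHom S (𝟙 X.pt)) f = f := by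
  obtain ⟨D, u, hu, v, hv, ξ, rfl⟩ := exists_cls hS f
  exact (ofHom_comp_cls hS (𝟙 X.pt) u hu v ξ).trans (by simp)

lemma comp_id {X Y : LObj F} (f : LHom S F X Y) : comp hS f (ofHom S (𝟙 Y.pt)) = f := by
  obtain ⟨D, u, hu, v, hv, ξ, rfl⟩ := exists_cls hS f
  exact (cls_comp_ofHom hS u hu v ξ (𝟙 Y.pt)).trans (by simp)

lemma assoc {X Y Z W : LObj F} (f : LHom S F X Y) (g : LHom S F Y Z) (h : LHom S F Z W) :
    comp hS (comp hS f g) h = comp hS f (comp hS g h) := by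
  obtain ⟨C₁, u₁, hu₁, v₁, -, ξ, rfl⟩ := exists_cls hS f
  obtain ⟨C₂, u₂, hu₂, v₂, -, ζ, rfl⟩ := exists_cls hS g
  obtain ⟨C₃, u₃, hu₃, v₃, -, χ, rfl⟩ := exists_cls hS h
  obtain ⟨D, r, s, γ, hr, hs, -⟩ := hS.exists_square v₁ u₂ hu₂
  obtain ⟨D', r', s', γ', hr', hs', -⟩ := hS.exists_square (v₂ ≫ s) u₃ hu₃
  rw [comp_cls hS r s hr hs γ, comp_cls hS r' s' hr' hs' γ',
    comp_cls hS (s ≫ r') s' (S.comp_mem _ _ hs hr') hs' ((α_ _ _ _).inv ≫ γ'),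
    comp_cls hS (r ≫ r') (𝟙 D') (S.comp_mem _ _ hr hr') (S.id_mem _)
      ((α_ _ _ _).inv ≫ γ ▷ r' ≫ (α_ _ _ _).hom ≫ (ρ_ _).inv)]
  exact (cls_eq hS (α_ _ _ _) (ρ_ _).hom (by simp)).symm

lemma ofHom_comp_ofHom {a : A} {x y z : F.obj a} (ξ : x ⟶ y) (η : y ⟶ z) :
    comp hS (ofHom S ξ) (ofHom S η) = ofHom S (ξ ≫ η) := by
  rw [ofHom_eq η, ofHom_comp_cls, ofHom_eq, ← Functor.map_comp]

lemma ofHom_comp_ofArrow {a b : A} (f : a ⟶ b) {x y : F.obj a} (ξ : x ⟶ y) :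
    comp hS (ofHom S ((F.map f).toFunctor.map ξ)) (ofArrow S f y) =
      comp hS (ofArrow S f x) (ofHom S ξ) := by
  rw [ofArrow_eq f y, ofHom_comp_cls, ofArrow_eq, cls_comp_ofHom]
  simp

lemma ofArrow_id (a : A) (x : F.obj a) : ofArrow S (𝟙 a) x =
    ofHom (x := (F.map (𝟙 a)).toFunctor.obj x) S (idIso F a x).hom := by
  rw [ofArrow_eq, ofHom_eq]
  congr 1
  simp

lemma ofArrow_comp {a b c : A} (f : a ⟶ b) (g : b ⟶ c) (x : F.obj a) :
    ofArrow S (f ≫ g) x = comp hS (ofHom S (compIso F f g x).hom)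
      (comp hS (ofArrow S g ((F.map f).toFunctor.obj x)) (ofArrow S f x)) := by
  rw [ofArrow_eq g, cls_comp_ofArrow, ofHom_comp_cls, ofArrow_eq]
  simp

lemma ofArrow_map₂ {a b : A} {f g : a ⟶ b} (γ : f ⟶ g) (x : F.obj a) :
    ofArrow S f x = comp hS (ofHom S (cellApp F γ x)) (ofArrow S g x) := by
  rw [ofArrow_eq g, ofHom_comp_cls, ofArrow_eq]
  exact cls_eq hS (Iso.refl _) γ (by simp)

lemma ofArrow_comp_cls {X Y : LObj F} {D : A} (u : X.base ⟶ D) (hu : S u) (v : Y.base ⟶ D)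
    (ξ : (F.map u).toFunctor.obj X.pt ⟶ (F.map v).toFunctor.obj Y.pt) :
    comp hS (ofArrow S u X.pt) (cls u hu v ξ) = comp hS (ofHom S ξ) (ofArrow S v Y.pt) := by
  rw [ofArrow_eq, comp_cls hS (𝟙 D) (𝟙 D) (S.id_mem D) (S.id_mem D) (𝟙 _), ofArrow_eq,
    ofHom_comp_cls]
  exact cls_eq hS (λ_ _).symm (ρ_ _).hom (by simp)

lemma ofArrow_comp_ofArrowInv {a b : A} (f : a ⟶ b) (hf : S f) (x : F.obj a) :
    comp hS (ofArrow S f x) (ofArrowInv f hf x) = ofHom S (𝟙 _) := by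
  refine (ofArrow_comp_cls hS (X := ⟨a, x⟩) (Y := ⟨b, (F.map f).toFunctor.obj x⟩) f hf (𝟙 b)
    _).trans ?_
  dsimp only
  rw [ofArrow_id, ofHom_comp_ofHom, Iso.inv_hom_id]

lemma ofArrowInv_comp_ofArrow {a b : A} (f : a ⟶ b) (hf : S f) (x : F.obj a) :
    comp hS (ofArrowInv f hf x) (ofArrow S f x) = ofHom S (𝟙 _) := by
  refine (cls_comp_ofArrow hS (X := ⟨a, x⟩) f x f hf (𝟙 b) _).trans ?_
  rw [ofHom_eq, cls_eq_push hS (X := ⟨a, x⟩) (Y := ⟨a, x⟩) (𝟙 a) _ (𝟙 a) _ f hf]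
  exact cls_eq hS (λ_ f) ((ρ_ f).hom ≫ (λ_ f).inv) (by simp)

lemma ofHom_comp_ofArrowInv {a b : A} (f : a ⟶ b) (hf : S f) {x y : F.obj a} (ξ : x ⟶ y) :
    comp hS (ofHom S ξ) (ofArrowInv f hf y) =
      comp hS (ofArrowInv f hf x) (ofHom S ((F.map f).toFunctor.map ξ)) := by
  refine (ofHom_comp_cls hS ξ _ _ _ _).trans (Eq.trans ?_ (cls_comp_ofHom hS _ _ _ _ _).symm)
  simp

end LHom

section ConeElements

variable {A : Type u₁} [Bicategory.{w₁, v₁} A] [Bicategory.Strict A] {S : MorphismProperty A}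
  {F : A ⥤ᵖ Cat.{v, u}} {E : Cat.{v, u}} (θ : SigmaCone S F E)

namespace SigmaCone

/-- The component at `x` of the natural transformation `θ_f`. -/
def homApp {a b : A} (f : a ⟶ b) (x : F.obj a) :
    (θ.app b).toFunctor.obj ((F.map f).toFunctor.obj x) ⟶ (θ.app a).toFunctor.obj x :=
  (θ.hom f).toNatTrans.app x

lemma homApp_naturality {a b : A} (f : a ⟶ b) {x y : F.obj a} (ξ : x ⟶ y) :
    (θ.app b).toFunctor.map ((F.map f).toFunctor.map ξ) ≫ θ.homApp f y =
      θ.homApp f x ≫ (θ.app a).toFunctor.map ξ :=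
  (θ.hom f).toNatTrans.naturality ξ

lemma homApp_id (a : A) (x : F.obj a) :
    θ.homApp (𝟙 a) x = (θ.app a).toFunctor.map (idIso F a x).hom := by
  refine (congrArg (fun η => η.toNatTrans.app x) (θ.hom_id a)).trans ?_
  exact Category.comp_id _

lemma homApp_comp {a b c : A} (f : a ⟶ b) (g : b ⟶ c) (x : F.obj a) :
    θ.homApp (f ≫ g) x = (θ.app c).toFunctor.map (compIso F f g x).hom ≫
      θ.homApp g ((F.map f).toFunctor.obj x) ≫ θ.homApp f x := by
  refine (congrArg (fun η => η.toNatTrans.app x) (θ.hom_comp f g)).trans ?_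
  simp only [Cat.Hom₂.comp_app]
  congr 1
  exact Category.id_comp _

lemma homApp_map₂ {a b : A} {f g : a ⟶ b} (γ : f ⟶ g) (x : F.obj a) :
    θ.homApp f x = (θ.app b).toFunctor.map (cellApp F γ x) ≫ θ.homApp g x :=
  congrArg (fun η => η.toNatTrans.app x) (θ.hom_map₂ γ)

lemma isIso_homApp {a b : A} (f : a ⟶ b) (hf : S f) (x : F.obj a) : IsIso (θ.homApp f x) := by
  have := θ.isIso_hom f hf
  exact inferInstanceAs
    (IsIso ((Cat.Hom.toNatIso (asIso (θ.hom f))).hom.app x))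

lemma homApp_compArrow {E' : Cat.{v, u}} (g : E ⟶ E') {a b : A} (f : a ⟶ b) (x : F.obj a) :
    (θ.compArrow g).homApp f x = g.toFunctor.map (θ.homApp f x) :=
  Category.id_comp _

variable {θ} in
lemma Hom.comm_app {θ' : SigmaCone S F E} (φ : Hom θ θ') {a b : A} (f : a ⟶ b) (x : F.obj a) :
    (φ.app b).toNatTrans.app ((F.map f).toFunctor.obj x) ≫ θ'.homApp f x =
      θ.homApp f x ≫ (φ.app a).toNatTrans.app x :=
  congrArg (fun η => η.toNatTrans.app x) (φ.comm f)

/-- The inverse of `(θ_f)_x` for `f` in `S`. -/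
noncomputable def invApp {a b : A} (f : a ⟶ b) (hf : S f) (x : F.obj a) :
    (θ.app a).toFunctor.obj x ⟶ (θ.app b).toFunctor.obj ((F.map f).toFunctor.obj x) :=
  @inv _ _ _ _ (θ.homApp f x) (θ.isIso_homApp f hf x)

@[simp]
lemma homApp_invApp {a b : A} (f : a ⟶ b) (hf : S f) (x : F.obj a) :
    θ.homApp f x ≫ θ.invApp f hf x = 𝟙 _ :=
  @IsIso.hom_inv_id _ _ _ _ _ (θ.isIso_homApp f hf x)

lemma invApp_comp_eq {a b : A} (f : a ⟶ b) (hf : S f) (x : F.obj a) {z : E}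
    (g : (θ.app b).toFunctor.obj ((F.map f).toFunctor.obj x) ⟶ z)
    (h : (θ.app a).toFunctor.obj x ⟶ z) :
    θ.invApp f hf x ≫ g = h ↔ g = θ.homApp f x ≫ h :=
  @IsIso.inv_comp_eq _ _ _ _ _ _ (θ.isIso_homApp f hf x) _ _

/-- The arrow of the vertex of a `σ`-cone defined by a premorphism. -/
noncomputable def eval {X Y : LObj F} (ξ : Premorphism S F X Y) :
    (θ.app X.base).toFunctor.obj X.pt ⟶ (θ.app Y.base).toFunctor.obj Y.pt :=
  θ.invApp ξ.left ξ.left_mem X.pt ≫ (θ.app ξ.apex).toFunctor.map ξ.cell ≫ θ.homApp ξ.right Y.pt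

lemma homApp_eval {X Y : LObj F} (ξ : Premorphism S F X Y) :
    θ.homApp ξ.left X.pt ≫ θ.eval ξ =
      (θ.app ξ.apex).toFunctor.map ξ.cell ≫ θ.homApp ξ.right Y.pt := by
  rw [eval, ← Category.assoc, homApp_invApp, Category.id_comp]

lemma eval_eq_iff {X Y : LObj F} (ξ : Premorphism S F X Y)
    (g : (θ.app X.base).toFunctor.obj X.pt ⟶ (θ.app Y.base).toFunctor.obj Y.pt) :
    θ.eval ξ = g ↔ (θ.app ξ.apex).toFunctor.map ξ.cell ≫ θ.homApp ξ.right Y.pt =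
      θ.homApp ξ.left X.pt ≫ g :=
  θ.invApp_comp_eq _ _ _ _ _

lemma eval_eq_of_extension {X Y : LObj F} {ξ ξ' : Premorphism S F X Y}
    (e : Premorphism.Extension ξ ξ') : θ.eval ξ' = θ.eval ξ := by
  rw [eval_eq_iff, θ.homApp_map₂ e.α.hom, homApp_comp, e.cell_eq, Premorphism.paste_eq]
  have h₁ := θ.homApp_map₂ e.β Y.pt
  have h₂ := θ.homApp_naturality e.w ξ.cell
  rw [homApp_comp] at h₁
  simp [← h₁, homApp_eval, ← reassoc_of% h₂]

lemma eval_eq_of_homotopic {X Y : LObj F} {ξ ξ' : Premorphism S F X Y}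
    (h : ξ.Homotopic ξ') : θ.eval ξ = θ.eval ξ' := by
  obtain ⟨ξ'', ⟨e⟩, ⟨e'⟩, -⟩ := Premorphism.homotopic_iff.1 h
  rw [← θ.eval_eq_of_extension e, ← θ.eval_eq_of_extension e']

lemma eval_compOver [S.IsMultiplicative] {X Y Z : LObj F} (ξ : Premorphism S F X Y)
    (ζ : Premorphism S F Y Z) (c : Premorphism.CompCell ξ ζ) :
    θ.eval (ξ.compOver ζ c) = θ.eval ξ ≫ θ.eval ζ := by
  obtain ⟨D, r, s, hr, hs, γ⟩ := c
  rw [Premorphism.compOver_mk, eval_eq_iff]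
  have h₁ := θ.homApp_naturality r ξ.cell
  have h₂ := θ.homApp_naturality s ζ.cell
  have h₃ := θ.homApp_map₂ γ Y.pt
  rw [homApp_comp, homApp_comp] at h₃
  have h₄ : θ.homApp r ((F.map ξ.right).toFunctor.obj Y.pt) ≫ θ.homApp ξ.right Y.pt =
      (θ.app D).toFunctor.map ((compIso F ξ.right r Y.pt).inv ≫ cellApp F γ Y.pt ≫
        (compIso F ζ.left s Y.pt).hom) ≫
          θ.homApp s ((F.map ζ.left).toFunctor.obj Y.pt) ≫ θ.homApp ζ.left Y.pt := by
    simp [← h₃]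
  simp only [homApp_comp, Category.assoc, reassoc_of% θ.homApp_eval ξ, ← reassoc_of% h₁,
    reassoc_of% h₄, homApp_eval, ← reassoc_of% h₂]
  simp

lemma eval_ofHom [S.IsMultiplicative] {a : A} {x y : F.obj a} (ξ : x ⟶ y) :
    θ.eval (Premorphism.ofHom S ξ) = (θ.app a).toFunctor.map ξ := by
  rw [eval_eq_iff]
  simp [Premorphism.ofHom, homApp_id, ← Functor.map_comp]

lemma eval_ofArrow [S.IsMultiplicative] {a b : A} (f : a ⟶ b) (x : F.obj a) :
    θ.eval (Premorphism.ofArrow S f x) = θ.homApp f x := by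
  rw [eval_eq_iff]
  change _ = θ.homApp (𝟙 b) _ ≫ _
  rw [homApp_id]
  rfl

variable {θ} in
lemma Hom.eval_naturality {θ' : SigmaCone S F E} (φ : Hom θ θ') {X Y : LObj F}
    (ξ : Premorphism S F X Y) :
    θ.eval ξ ≫ (φ.app Y.base).toNatTrans.app Y.pt =
      (φ.app X.base).toNatTrans.app X.pt ≫ θ'.eval ξ := by
  rw [eval, Category.assoc, invApp_comp_eq, ← reassoc_of% φ.comm_app ξ.left X.pt, homApp_eval,
    Category.assoc, ← φ.comm_app]
  simp

/-- The arrow of the vertex of a `σ`-cone defined by a class of premorphisms. -/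
noncomputable def evalHom {X Y : LObj F} (f : LHom S F X Y) :
    (θ.app X.base).toFunctor.obj X.pt ⟶ (θ.app Y.base).toFunctor.obj Y.pt :=
  Quot.lift (fun ξ : Premorphism S F X Y => θ.eval ξ) (fun _ _ h => θ.eval_eq_of_homotopic h) f

lemma evalHom_comp [S.IsMultiplicative] (hS : IsSigmaFiltered S) {X Y Z : LObj F}
    (f : LHom S F X Y) (g : LHom S F Y Z) :
    θ.evalHom (LHom.comp hS f g) = θ.evalHom f ≫ θ.evalHom g := by
  obtain ⟨ξ, rfl⟩ := Quot.exists_rep f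
  obtain ⟨ζ, rfl⟩ := Quot.exists_rep g
  obtain ⟨c⟩ := Premorphism.nonempty_compCell hS ξ ζ
  exact (congrArg θ.evalHom (LHom.comp_mk hS ξ ζ c)).trans (θ.eval_compOver ξ ζ c)

lemma ext_app {θ θ' : SigmaCone S F E} (h : ∀ a, θ.app a = θ'.app a)
    (h' : ∀ {a b : A} (f : a ⟶ b) (x : F.obj a), HEq (θ.homApp f x) (θ'.homApp f x)) :
    θ = θ' := by
  obtain ⟨app, hom, _, _, _, _⟩ := θ
  obtain ⟨app', hom', _, _, _, _⟩ := θ'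
  obtain rfl : app = app' := funext h
  obtain rfl : @hom = @hom' := by
    funext a b f
    refine Cat.Hom₂.ext (NatTrans.ext (funext fun x => eq_of_heq (h' f x)))
  rfl

lemma eqToHom_app {θ θ' : SigmaCone S F E} (h : θ = θ') (a : A) :
    Hom.app (eqToHom h) a = eqToHom (congrArg (fun θ => θ.app a) h) := by
  subst h
  rfl

end SigmaCone

end ConeElements

section Colimit

variable {A : Type u₁} [Bicategory.{w₁, v₁} A] [Bicategory.Strict A] {S : MorphismProperty A}
  [S.IsMultiplicative] (hS : IsSigmaFiltered S)

/-- The category structure of `L_σ(F)`. -/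
noncomputable def lCategory (F : A ⥤ᵖ Cat.{v, u}) : LCategory S F where
  comp f g := LHom.comp hS f g
  comp_mk ξ ζ c := LHom.comp_mk hS ξ ζ c
  id_comp f := LHom.id_comp hS f
  comp_id f := LHom.comp_id hS f
  assoc f g h := LHom.assoc hS f g h

variable (F : A ⥤ᵖ Cat.{max u₁ v₁ v, max u₁ u})

/-- The category `L_σ(F)`. -/
noncomputable abbrev lCat : Cat.{max u₁ v₁ v, max u₁ u} := (lCategory hS F).toCat

/-- The functor `λ_a`. -/
noncomputable def lInclusion (a : A) : F.obj a ⟶ lCat.{w₁, v₁, u₁, v, u} hS F where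
  toFunctor :=
    { obj := fun x => ((lCategory hS F).inclusion a).obj x
      map := fun ξ => ((lCategory hS F).inclusion a).map ξ
      map_id := fun _ => rfl
      map_comp := fun ξ η => (LHom.ofHom_comp_ofHom hS ξ η).symm }

/-- The natural transformation `λ_f`. -/
noncomputable def lHom {a b : A} (f : a ⟶ b) :
    F.map f ≫ lInclusion.{w₁, v₁, u₁, v, u} hS F b ⟶ lInclusion.{w₁, v₁, u₁, v, u} hS F a where
  toNatTrans :=
    { app := fun x => LHom.ofArrow S f x
      naturality := fun _ _ ξ => LHom.ofHom_comp_ofArrow hS f ξ }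

/-- The natural transformation inverse to `λ_f` for `f` in `S`. -/
noncomputable def lHomInv {a b : A} (f : a ⟶ b) (hf : S f) :
    lInclusion.{w₁, v₁, u₁, v, u} hS F a ⟶ F.map f ≫ lInclusion.{w₁, v₁, u₁, v, u} hS F b where
  toNatTrans :=
    { app := fun x => LHom.ofArrowInv f hf x
      naturality := fun _ _ ξ => LHom.ofHom_comp_ofArrowInv hS f hf ξ }

/-- The `σ`-cone `λ` with vertex `L_σ(F)`. -/
noncomputable def lCone : SigmaCone S F (lCat.{w₁, v₁, u₁, v, u} hS F) where
  app := lInclusion.{w₁, v₁, u₁, v, u} hS F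
  hom := lHom.{w₁, v₁, u₁, v, u} hS F
  hom_id a := by
    refine Cat.Hom₂.ext (NatTrans.ext (funext fun x => ?_))
    refine (LHom.ofArrow_id a x).trans ?_
    exact (LHom.comp_id hS (LHom.ofHom (x := (F.map (𝟙 a)).toFunctor.obj x) S
      (idIso F a x).hom)).symm
  hom_comp f g := by
    refine Cat.Hom₂.ext (NatTrans.ext (funext fun x => ?_))
    refine (LHom.ofArrow_comp hS f g x).trans ?_
    exact congrArg (LHom.comp hS _) (LHom.id_comp hS (LHom.comp hS
      (LHom.ofArrow S g ((F.map f).toFunctor.obj x)) (LHom.ofArrow S f x))).symm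
  hom_map₂ γ := Cat.Hom₂.ext (NatTrans.ext (funext fun x => LHom.ofArrow_map₂ hS γ x))
  isIso_hom f hf :=
    ⟨lHomInv.{w₁, v₁, u₁, v, u} hS F f hf,
      Cat.Hom₂.ext (NatTrans.ext (funext fun x => LHom.ofArrow_comp_ofArrowInv hS f hf x)),
      Cat.Hom₂.ext (NatTrans.ext (funext fun x => LHom.ofArrowInv_comp_ofArrow hS f hf x))⟩

variable {F} {E : Cat.{max u₁ v₁ v, max u₁ u}}

/-- The functor `L_σ(F) ⥤ E` induced by a `σ`-cone with vertex `E`. -/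
noncomputable def lLift (θ : SigmaCone S F E) : lCat.{w₁, v₁, u₁, v, u} hS F ⟶ E where
  toFunctor :=
    { obj := fun X : LObj F => (θ.app X.base).toFunctor.obj X.pt
      map := fun f => θ.evalHom f
      map_id := fun X => (θ.eval_ofHom (𝟙 X.pt)).trans
        ((θ.app X.base).toFunctor.map_id _)
      map_comp := fun f g => θ.evalHom_comp hS f g }

/-- The natural transformation induced by a morphism of `σ`-cones. -/
noncomputable def lLiftMap {θ θ' : SigmaCone S F E} (φ : SigmaCone.Hom θ θ') :
    lLift.{w₁, v₁, u₁, v, u} hS θ ⟶ lLift.{w₁, v₁, u₁, v, u} hS θ' where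
  toNatTrans :=
    { app := fun X : LObj F => (φ.app X.base).toNatTrans.app X.pt
      naturality := fun X Y f => by
        obtain ⟨ξ, rfl⟩ := Quot.exists_rep f
        exact φ.eval_naturality ξ }

lemma lLift_compArrow (g : lCat.{w₁, v₁, u₁, v, u} hS F ⟶ E) : lLift.{w₁, v₁, u₁, v, u} hS ((lCone.{w₁, v₁, u₁, v, u} hS F).compArrow g) = g := by
  refine Cat.Hom.ext (Functor.hext (fun _ => rfl) fun X Y f => heq_of_eq ?_)
  obtain ⟨ξ, rfl⟩ := Quot.exists_rep f
  refine (SigmaCone.eval_eq_iff _ ξ _).2 ?_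
  let _ := (lCategory hS F).category
  have h : (LHom.ofArrow S ξ.left X.pt ≫ LHom.mk ξ : (_ : LObj F) ⟶ _) =
      LHom.ofHom S ξ.cell ≫ LHom.ofArrow S ξ.right Y.pt :=
    LHom.ofArrow_comp_cls hS ξ.left ξ.left_mem ξ.right ξ.cell
  rw [SigmaCone.homApp_compArrow, SigmaCone.homApp_compArrow]
  exact (g.toFunctor.map_comp _ _).symm.trans ((congrArg _ h.symm).trans
    (g.toFunctor.map_comp _ _))

lemma compArrow_lLift (θ : SigmaCone S F E) : (lCone.{w₁, v₁, u₁, v, u} hS F).compArrow (lLift.{w₁, v₁, u₁, v, u} hS θ) = θ := by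
  refine SigmaCone.ext_app (fun a => ?_) fun f x => heq_of_eq ?_
  · refine Cat.Hom.ext (Functor.hext (fun _ => rfl) fun x y ξ => heq_of_eq ?_)
    exact θ.eval_ofHom ξ
  · exact (Category.id_comp _).trans (θ.eval_ofArrow f x)

theorem isColimit_lCone : (lCone.{w₁, v₁, u₁, v, u} hS F).IsColimit := fun E => by
  refine ⟨{
      obj := lLift.{w₁, v₁, u₁, v, u} hS
      map := fun φ => lLiftMap.{w₁, v₁, u₁, v, u} hS φ
      map_id := fun _ => rfl
      map_comp := fun _ _ => rfl }, ?_, ?_⟩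
  · refine CategoryTheory.Functor.ext (fun g => lLift_compArrow.{w₁, v₁, u₁, v, u} hS g) fun g g' η => ?_
    refine Cat.Hom₂.ext (NatTrans.ext (funext fun X => ?_))
    refine Eq.trans ?_ (congrArg₂ (· ≫ ·) (Cat.eqToHom_app _ _ (lLift_compArrow.{w₁, v₁, u₁, v, u} hS g) X)
      (congrArg (η.toNatTrans.app X ≫ ·)
        (Cat.eqToHom_app _ _ (lLift_compArrow.{w₁, v₁, u₁, v, u} hS g').symm X))).symm
    exact ((Category.id_comp _).trans (Category.comp_id _)).symm
  · refine CategoryTheory.Functor.ext (fun θ => compArrow_lLift.{w₁, v₁, u₁, v, u} hS θ) fun θ θ' φ => ?_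
    refine SigmaCone.Hom.ext (funext fun a => Cat.Hom₂.ext (NatTrans.ext (funext fun x => ?_)))
    have h₁ : (SigmaCone.Hom.app (eqToHom (compArrow_lLift.{w₁, v₁, u₁, v, u} hS θ)) a).toNatTrans.app x = 𝟙 _ := by
      rw [SigmaCone.eqToHom_app, Cat.eqToHom_app]
      rfl
    have h₂ : (SigmaCone.Hom.app (eqToHom (compArrow_lLift.{w₁, v₁, u₁, v, u} hS θ').symm) a).toNatTrans.app x =
        𝟙 _ := by
      rw [SigmaCone.eqToHom_app, Cat.eqToHom_app]
      rfl
    refine Eq.trans ?_ (congrArg₂ (· ≫ ·) h₁ (congrArg ((φ.app a).toNatTrans.app x ≫ ·) h₂)).symm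
    exact ((Category.id_comp _).trans (Category.comp_id _)).symm

end Colimit

end SigmaColimit

theorem theorem2p12 {A : Type u₁} [Bicategory.{w₁, v₁} A] [Bicategory.Strict A]
    (S : MorphismProperty A) [S.IsMultiplicative] (hS : IsSigmaFiltered S)
    (F : StrictPseudofunctor A Cat.{max u₁ v₁ v, max u₁ u}) :
    -- homotopy is an equivalence relation
    (∀ X Y : LObj F.toPseudofunctor,
      Equivalence (Premorphism.Homotopic (S := S) (X := X) (Y := Y))) ∧
    -- composable premorphisms can be composed over some 2-cell
    (∀ {X Y Z : LObj F.toPseudofunctor} (ξ : Premorphism S F.toPseudofunctor X Y)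
      (ζ : Premorphism S F.toPseudofunctor Y Z), Nonempty (Premorphism.CompCell ξ ζ)) ∧
    -- homotopy is compatible with composition
    (∀ {X Y Z : LObj F.toPseudofunctor} (ξ₁ ξ₂ : Premorphism S F.toPseudofunctor X Y)
      (ζ₁ ζ₂ : Premorphism S F.toPseudofunctor Y Z)
      (c₁ : Premorphism.CompCell ξ₁ ζ₁) (c₂ : Premorphism.CompCell ξ₂ ζ₂),
      ξ₁.Homotopic ξ₂ → ζ₁.Homotopic ζ₂ →
        (ξ₁.compOver ζ₁ c₁).Homotopic (ξ₂.compOver ζ₂ c₂)) ∧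
    -- the classes of premorphisms form a category, and the given formulas define a `σ`-cone
    -- with this category as vertex, which is the `σ`-colimit of `F` in `Cat`
    ∃ (L : LCategory S F.toPseudofunctor) (l : SigmaCone S F.toPseudofunctor L.toCat),
      (∀ a : A, (l.app a).toFunctor.toPrefunctor = L.inclusion a) ∧
      (∀ {a b : A} (f : a ⟶ b) (x : F.obj a),
        HEq ((l.hom f).toNatTrans.app x)
          (LHom.mk (Premorphism.ofArrow (F := F.toPseudofunctor) S f x))) ∧
      l.IsColimit := by
  exact ⟨fun X Y => Premorphism.equivalence_homotopic hS X Y,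
    fun ξ ζ => Premorphism.nonempty_compCell hS ξ ζ,
    fun _ _ _ _ c₁ c₂ hξ hζ => Premorphism.Homotopic.compOver hS c₁ c₂ hξ hζ,
    lCategory hS F.toPseudofunctor, lCone.{w₁, v₁, u₁, v, u} hS F.toPseudofunctor,
    fun _ => rfl, fun _ _ => HEq.rfl, isColimit_lCone.{w₁, v₁, u₁, v, u} hS⟩
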